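/- Let $R$ be a commutative Artinian ring and let $\Lambda$ be an Artin $R$-algebra, that is, an $R$-algebra which is finitely generated as an $R$-module. Let $D=\mathrm{Hom}_R(-,k)$, where $k$ is the injective envelope of $R/\mathrm{rad}(R)$, and let $\nu=D\,\mathrm{Hom}_\Lambda(-,\Lambda)$ be the Nakayama functor. For a finitely generated left $\Lambda$-module $M$ fix a minimal projective resolution $\cdots\to P^{-1}(M)\xrightarrow{\pi_M^{-1}}P^0(M)\to M\to 0$, with syzygies $\Omega^iM$, and let $P^\bullet_{\geq -n}(M)$ be the complex $P^{-n}(M)\to\cdots\to P^0(M)$ concentrated in degrees $-n,\dots,0$. Put $\tau(M)=\mathrm{Ker}(\nu(\pi_M^{-1}))$ and $\tau_n(M)=\tau(\Omega^{n-1}M)$ for $n\geq 1$. A complex $X\in\mathsf{K}^b(\mathrm{proj}\,\Lambda)$ is silting if $\mathrm{Hom}_{\mathsf{K}^b(\mathrm{proj}\,\Lambda)}(X,X[i])=0$ for all $i>0$ and $\mathsf{K}^b(\mathrm{proj}\,\Lambda)$ is the smallest triangulated subcategory (closed under isomorphisms) containing $\mathrm{add}(X)$. For $n,m\geq 1$,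 the module $M$ is - $\tau_n$-rigid in $\mathrm{mod}(\Lambda)$ if $\mathrm{Hom}_\Lambda(M,\tau_n(M))=0$ and $\mathrm{Ext}^i_\Lambda(M,M)=0$ for $1\leq i\leq n-1$; - $\tau_n$-tilting in $\mathrm{mod}(\Lambda)$ if $P^\bullet_{\geq -n}(M)$ is silting in $\mathsf{K}^b(\mathrm{proj}\,\Lambda)$; - $\tau_{n,m}$-tilting in $\mathrm{mod}(\Lambda)$ if it is $\tau_n$-tilting in $\mathrm{mod}(\Lambda)$ and $\tau_m$-rigid in $\mathrm{mod}(\Gamma_M)$, where $\Gamma_M=\Lambda/\mathrm{ann}(M)$. **Proposition.** Every finitely generated $\tau_1$-tilting $\Lambda$-module $M$ is $\tau_{1,1}$-tilting; that is, $M$ is also $\tau_1$-rigid (i.e. $\tau$-rigid: $\mathrm{Hom}_{\Gamma_M}(M,\tau_{\Gamma_M}(M))=0$) as a module over $\Gamma_M$. -/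

import Mathlib

open CategoryTheory

universe u w

noncomputable section

namespace TauTilting

/-! ### Injective envelopes and the injective envelope of `R / rad R` -/

/-- `f : S → E` is an injective envelope: `E` is injective and `f` is an essential
monomorphism. -/
structure IsInjectiveEnvelope (R : Type w) [CommRing R] {S E : Type w} [AddCommGroup S]
    [Module R S] [AddCommGroup E] [Module R E] (f : S →ₗ[R] E) : Prop where
  injective : Function.Injective f
  moduleInjective : Module.Injective R E
  essential : ∀ N : Submodule R E, N ⊓ LinearMap.range f = ⊥ → N = ⊥

theorem exists_isInjectiveEnvelope (R : Type w) [CommRing R] (S : Type w) [AddCommGroup S]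
    [Module R S] : ∃ (E : ModuleCat.{w} R) (f : S →ₗ[R] E), IsInjectiveEnvelope R f := by
  obtain ⟨⟨J, hJ, i, hi⟩⟩ := EnoughInjectives.presentation (ModuleCat.of R S)
  have hJ' : Module.Injective R J := (Module.injective_iff_injective_object R J).mpr hJ
  have hi' : Function.Injective i.hom := (ModuleCat.mono_iff_injective i).mp hi
  set A : Submodule R J := LinearMap.range i.hom with hA
  -- a maximal essential extension `N` of `A` inside `J`
  obtain ⟨N, hAN, hN⟩ := zorn_le_nonempty₀
    {N : Submodule R J | ∀ x ∈ N, x ≠ 0 → ∃ r : R, r • x ≠ 0 ∧ r • x ∈ A} (by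
      intro c hc hch N₀ hN₀
      refine ⟨sSup c, ?_, fun z hz => le_sSup hz⟩
      intro x hx hx0
      obtain ⟨N, hN, hxN⟩ := (Submodule.mem_sSup_of_directed ⟨N₀, hN₀⟩ hch.directedOn).mp hx
      exact hc hN x hxN hx0) A (fun x hx hx0 => ⟨1, by simpa using hx0, by simpa using hx⟩)
  -- a maximal complement `C` of `N` in `J`
  obtain ⟨C, -, hC⟩ := zorn_le_nonempty₀ {C : Submodule R J | ∀ x ∈ C, x ∈ N → x = 0} (by
      intro c hc hch N₀ hN₀
      refine ⟨sSup c, ?_, fun z hz => le_sSup hz⟩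
      intro x hx hxN
      obtain ⟨N, hN, hxN'⟩ := (Submodule.mem_sSup_of_directed ⟨N₀, hN₀⟩ hch.directedOn).mp hx
      exact hc hN x hxN' hxN) ⊥ (fun x hx _ => by simpa using hx)
  let q : N →ₗ[R] J ⧸ C := C.mkQ ∘ₗ N.subtype
  have hq : Function.Injective q := by
    rw [injective_iff_map_eq_zero]
    intro x hx
    have : (x : J) ∈ C := by simpa [q] using hx
    exact Subtype.ext (hC.prop _ this x.2)
  obtain ⟨h, hh⟩ := Module.Injective.out q hq N.subtype
  have key : ∀ y : J ⧸ C, y ≠ 0 → ∃ (r : R) (n : N), n ≠ 0 ∧ r • y = q n := by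
    intro y hy
    obtain ⟨e, rfl⟩ := C.mkQ_surjective y
    have heC : e ∉ C := fun hmem => hy (by simpa using hmem)
    by_contra! hcon
    have hmem : C ⊔ Submodule.span R {e} ∈
        {C : Submodule R J | ∀ x ∈ C, x ∈ N → x = 0} := by
      intro x hx hxN
      obtain ⟨c, hc, z, hz, rfl⟩ := Submodule.mem_sup.mp hx
      obtain ⟨r, rfl⟩ := Submodule.mem_span_singleton.mp hz
      by_contra hne
      refine hcon r ⟨_, hxN⟩ (fun h0 => hne (by simpa using h0)) ?_
      have : (Submodule.Quotient.mk c : J ⧸ C) = 0 := by simpa using hc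
      simp [q, this]
    exact heC (hC.le_of_ge hmem le_sup_left
      (Submodule.mem_sup_right (Submodule.mem_span_singleton_self e)))
  have hN' : LinearMap.range h ≤ N := by
    refine hN.le_of_ge ?_ ?_
    · rintro x ⟨y, rfl⟩ hx0
      obtain ⟨r, n, hn0, hr⟩ := key y (fun h0 => hx0 (by simp [h0]))
      obtain ⟨s, hs0, hsA⟩ := hN.prop n n.2 (by simpa using hn0)
      have h1 : (s * r) • h y = s • (n : J) := by
        rw [mul_smul, ← map_smul, hr, hh]; rfl
      exact ⟨s * r, by rwa [h1], by rwa [h1]⟩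
    · intro x hx
      exact ⟨q ⟨x, hx⟩, hh _⟩
  let ρ : J →ₗ[R] N := (h ∘ₗ C.mkQ).codRestrict N (fun x => hN' ⟨_, rfl⟩)
  have hρ : ∀ x : N, ρ x = x := fun x => Subtype.ext (hh x)
  refine ⟨ModuleCat.of R N, i.hom.codRestrict N (fun x => hAN ⟨x, rfl⟩), ?_, ?_, ?_⟩
  · intro x y hxy
    exact hi' (congrArg Subtype.val hxy)
  · constructor
    intro X Y _ _ _ _ f hf g
    obtain ⟨g', hg'⟩ := Module.Injective.out f hf (N.subtype ∘ₗ g)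
    exact ⟨ρ ∘ₗ g', fun x => by
      have := hg' x
      simp only [LinearMap.comp_apply] at this ⊢
      rw [this]; exact hρ _⟩
  · intro K hK
    rw [Submodule.eq_bot_iff]
    intro x hx
    by_contra hx0
    obtain ⟨r, hr0, s, hs⟩ := hN.prop x.1 x.2 (fun h0 => hx0 (Subtype.ext h0))
    have : r • x ∈ (⊥ : Submodule R N) := by
      rw [← hK]
      exact ⟨K.smul_mem r hx, ⟨s, Subtype.ext hs⟩⟩
    exact hr0 (congrArg Subtype.val ((Submodule.mem_bot R).mp this))

/-- The injective envelope `k` of the `R`-module `R / rad R` (a fixed choice). -/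
def dualizing (R : Type w) [CommRing R] : ModuleCat.{w} R :=
  (exists_isInjectiveEnvelope R (R ⧸ Ring.jacobson R)).choose

theorem dualizing_spec (R : Type w) [CommRing R] :
    ∃ f : (R ⧸ Ring.jacobson R) →ₗ[R] dualizing R, IsInjectiveEnvelope R f :=
  (exists_isInjectiveEnvelope R (R ⧸ Ring.jacobson R)).choose_spec

/-! ### Projective covers, syzygies and the minimal projective resolution -/

/-- `p : P → M` is a projective cover: `P` is a finitely generated projective module and `p` is
an epimorphism with superfluous kernel. -/
structure IsProjectiveCover {Λ : Type u} [Ring Λ] {P M : Type u} [AddCommGroup P] [Module Λ P]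
    [AddCommGroup M] [Module Λ M] (p : P →ₗ[Λ] M) : Prop where
  finite : Module.Finite Λ P
  projective : Module.Projective Λ P
  surjective : Function.Surjective p
  superfluous : ∀ N : Submodule Λ P, N ⊔ LinearMap.ker p = ⊤ → N = ⊤

theorem exists_isProjectiveCover (Λ : Type u) [Ring Λ] [IsArtinianRing Λ] (M : Type u)
    [AddCommGroup M] [Module Λ M] [Module.Finite Λ M] :
    ∃ (P : ModuleCat.{u} Λ) (p : P →ₗ[Λ] M), IsProjectiveCover p := by
  classical
  -- a finitely generated projective module of minimal length which maps onto `M`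
  let good : ℕ∞ → Prop := fun l => ∃ (P : ModuleCat.{u} Λ) (p : P →ₗ[Λ] M),
    Module.Finite Λ P ∧ Module.Projective Λ P ∧ Function.Surjective p ∧ Module.length Λ P = l
  have hex : ∃ l, good l := by
    obtain ⟨n, f, hf⟩ := Module.Finite.exists_fin' Λ M
    exact ⟨_, ModuleCat.of Λ (Fin n → Λ), f, inferInstanceAs (Module.Finite Λ (Fin n → Λ)),
      inferInstanceAs (Module.Projective Λ (Fin n → Λ)), hf, rfl⟩
  obtain ⟨P, p, hfin, hproj, hsurj, hlen⟩ := WellFounded.min_mem (s := {l | good l}) wellFounded_lt hex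
  refine ⟨P, p, hfin, hproj, hsurj, fun N hN => ?_⟩
  have hsurjN : Function.Surjective (p ∘ₗ N.subtype) := by
    intro m
    obtain ⟨x, rfl⟩ := hsurj m
    obtain ⟨y, hy, z, hz, rfl⟩ := Submodule.mem_sup.mp (hN ▸ Submodule.mem_top : x ∈ N ⊔ _)
    exact ⟨⟨y, hy⟩, by simp [LinearMap.mem_ker.mp hz]⟩
  obtain ⟨g, hg⟩ := Module.projective_lifting_property (p ∘ₗ N.subtype) p hsurjN
  let φ : Module.End Λ P := N.subtype ∘ₗ g
  have hφ : ∀ x, p (φ x) = p x := fun x => LinearMap.congr_fun hg x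
  have hφn : ∀ (n : ℕ) x, p ((φ ^ n) x) = p x := by
    intro n
    induction n with
    | zero => simp
    | succ n ih => intro x; rw [pow_succ', Module.End.mul_apply, hφ, ih]
  obtain ⟨n, hcompl, hn⟩ := ((φ.eventually_isCompl_ker_pow_range_pow).and
    (Filter.eventually_ge_atTop 1)).exists
  let Q := LinearMap.range (φ ^ n)
  have hQproj : Module.Projective Λ Q := by
    refine Module.Projective.of_split Q.subtype (Q.projectionOnto _ hcompl.symm) ?_
    ext x
    simp
  have hQsurj : Function.Surjective (p ∘ₗ Q.subtype) := by
    intro m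
    obtain ⟨x, rfl⟩ := hsurj m
    exact ⟨⟨_, x, rfl⟩, hφn n x⟩
  have hle := WellFounded.min_le (s := {l | good l}) wellFounded_lt
    (x := Module.length Λ Q) ⟨ModuleCat.of Λ Q, p ∘ₗ Q.subtype, inferInstanceAs (Module.Finite Λ Q),
      hQproj, hQsurj, rfl⟩
  rw [← hlen] at hle
  have hQtop : Q = ⊤ := by
    by_contra hne
    exact absurd (Submodule.length_lt hne) (not_lt.mpr hle)
  rw [eq_top_iff]
  intro x _
  obtain ⟨y, rfl⟩ := (hQtop ▸ Submodule.mem_top : x ∈ Q)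
  obtain ⟨k, rfl⟩ := Nat.exists_eq_add_of_le' hn
  rw [pow_succ', Module.End.mul_apply]
  exact (g _).2

section Resolution

variable (Λ : Type u) [Ring Λ] [IsArtinianRing Λ] (M : Type u) [AddCommGroup M] [Module Λ M]
  [Module.Finite Λ M]

/-- A fixed projective cover of the finitely generated module `M`. -/
def projCover : ModuleCat.{u} Λ := (exists_isProjectiveCover Λ M).choose

/-- The projective cover map `projCover Λ M → M`. -/
def projCoverMap : projCover Λ M →ₗ[Λ] M := (exists_isProjectiveCover Λ M).choose_spec.choose

theorem projCoverMap_spec : IsProjectiveCover (projCoverMap Λ M) :=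
  (exists_isProjectiveCover Λ M).choose_spec.choose_spec

instance : Module.Finite Λ (projCover Λ M) := (projCoverMap_spec Λ M).finite

instance : Module.Projective Λ (projCover Λ M) := (projCoverMap_spec Λ M).projective

/-- The syzygies `Ω⁰ M = M`, `Ωⁱ⁺¹ M = ker (P(Ωⁱ M) → Ωⁱ M)`, together with the fact that they are
finitely generated. -/
def syzygyAux : ℕ → {N : ModuleCat.{u} Λ // Module.Finite Λ N}
  | 0 => ⟨ModuleCat.of Λ M, inferInstanceAs (Module.Finite Λ M)⟩
  | i + 1 =>
    haveI := (syzygyAux i).2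
    ⟨ModuleCat.of Λ (LinearMap.ker (projCoverMap Λ (syzygyAux i).1)),
      inferInstanceAs (Module.Finite Λ (LinearMap.ker (projCoverMap Λ (syzygyAux i).1)))⟩

/-- The `i`-th syzygy `Ωⁱ M`. -/
def syzygy (i : ℕ) : ModuleCat.{u} Λ := (syzygyAux Λ M i).1

instance (i : ℕ) : Module.Finite Λ (syzygy Λ M i) := (syzygyAux Λ M i).2

/-- The term `P⁻ⁱ(M)` of the minimal projective resolution of `M`. -/
def resTerm (i : ℕ) : ModuleCat.{u} Λ := projCover Λ (syzygy Λ M i)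

/-- The projective cover `P⁻ⁱ(M) → Ωⁱ M`. -/
def resCover (i : ℕ) : resTerm Λ M i →ₗ[Λ] syzygy Λ M i := projCoverMap Λ (syzygy Λ M i)

/-- The inclusion `Ωⁱ⁺¹ M → P⁻ⁱ(M)`. -/
def syzygyIncl (i : ℕ) : syzygy Λ M (i + 1) →ₗ[Λ] resTerm Λ M i :=
  (LinearMap.ker (projCoverMap Λ (syzygy Λ M i))).subtype

/-- The differential `π⁻⁽ⁱ⁺¹⁾ : P⁻⁽ⁱ⁺¹⁾(M) → P⁻ⁱ(M)` of the minimal projective resolution. -/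
def resD (i : ℕ) : resTerm Λ M (i + 1) →ₗ[Λ] resTerm Λ M i :=
  syzygyIncl Λ M i ∘ₗ resCover Λ M (i + 1)

theorem resCover_comp_syzygyIncl (i : ℕ) : resCover Λ M i ∘ₗ syzygyIncl Λ M i = 0 :=
  LinearMap.ext fun x => LinearMap.mem_ker.mp
    (show (x : LinearMap.ker (projCoverMap Λ (syzygy Λ M i))).1 ∈ _ from x.2)

theorem resD_comp_resD (i : ℕ) : resD Λ M i ∘ₗ resD Λ M (i + 1) = 0 := by
  unfold resD
  rw [LinearMap.comp_assoc, ← LinearMap.comp_assoc (resCover Λ M (i + 2)),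
    resCover_comp_syzygyIncl, LinearMap.zero_comp, LinearMap.comp_zero]

/-- The minimal projective resolution `⋯ → P⁻¹(M) → P⁰(M)` as a chain complex. -/
def minRes : ChainComplex (ModuleCat.{u} Λ) ℕ :=
  ChainComplex.of (resTerm Λ M) (fun i => ModuleCat.ofHom (resD Λ M i))
    (fun i => ModuleCat.hom_ext (resD_comp_resD Λ M i))

/-- The cochain complex `P^•(M)`: the term `P⁻ⁱ(M)` sits in degree `-i`, and the terms in positive
degrees are zero. -/
def resComplex : CochainComplex (ModuleCat.{u} Λ) ℤ :=
  (minRes Λ M).extend ComplexShape.embeddingDownNat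

/-- The truncated complex `P^•_{≥ -n}(M)`, which agrees with `P^•(M)` in degrees `≥ -n` and is zero
in degrees `< -n`. -/
def truncRes (n : ℕ) : CochainComplex (ModuleCat.{u} Λ) ℤ :=
  (resComplex Λ M).stupidTrunc (ComplexShape.embeddingUpIntGE (-(n : ℤ)))

end Resolution

/-! ### Silting complexes in `K^b(proj Λ)`

`K^b(proj Λ)` is treated as the strictly full triangulated subcategory `kbProj Λ` of the homotopy
category `K(Mod Λ)`. -/

section Silting

variable (Λ : Type u) [Ring Λ]

/-- The homotopy category of cochain complexes of `Λ`-modules. -/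
abbrev KMod : Type (u + 1) := HomotopyCategory (ModuleCat.{u} Λ) (ComplexShape.up ℤ)

/-- `K^b(proj Λ)`: the objects of `K(Mod Λ)` isomorphic to a bounded complex of finitely generated
projective modules. -/
def kbProj : ObjectProperty (KMod Λ) := fun X =>
  ∃ K : CochainComplex (ModuleCat.{u} Λ) ℤ,
    (∃ a b : ℤ, ∀ i, i < a ∨ b < i → Limits.IsZero (K.X i)) ∧
    (∀ i, Module.Finite Λ (K.X i) ∧ Module.Projective Λ (K.X i)) ∧
    Nonempty (X ≅ (HomotopyCategory.quotient (ModuleCat.{u} Λ) (ComplexShape.up ℤ)).obj K)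

variable {Λ}

/-- `add(X)`: the direct summands of finite direct sums of copies of `X`. -/
def addClosure (X : KMod Λ) : ObjectProperty (KMod Λ) := fun Y =>
  ∃ (n : ℕ) (b : Limits.Bicone (fun _ : Fin n => X)),
    Nonempty b.IsBilimit ∧ Nonempty (Retract Y b.pt)

/-- `X` is presilting: it lies in `K^b(proj Λ)` and `Hom(X, X[i]) = 0` for all `i > 0`. -/
def IsPresilting (X : KMod Λ) : Prop :=
  kbProj Λ X ∧ ∀ i : ℤ, 0 < i → ∀ f : X ⟶ (shiftFunctor (KMod Λ) i).obj X, f = 0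

/-- `X` is silting: it is presilting and `K^b(proj Λ)` is the smallest (strictly full) triangulated
subcategory containing `add(X)`. -/
def IsSilting (X : KMod Λ) : Prop :=
  IsPresilting X ∧
    ∀ S : ObjectProperty (KMod Λ), S.IsTriangulated → S.IsClosedUnderIsomorphisms →
      addClosure X ≤ S → kbProj Λ ≤ S

end Silting

/-! ### The Nakayama functor and the higher Auslander-Reiten translations -/

section Translation

variable (R : Type w) [CommRing R] (Λ : Type u) [Ring Λ] [Algebra R Λ]

/-- `ν(P) = D(P^*) = Hom_R(Hom_Λ(P, Λ), k)`, where `k` is the injective envelope of `R / rad R`. -/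
def Nakayama (P : Type u) [AddCommGroup P] [Module Λ P] : Type (max u w) :=
  (P →ₗ[Λ] Λ) →ₗ[R] dualizing R

section Structure

variable (P Q : Type u) [AddCommGroup P] [Module Λ P] [AddCommGroup Q] [Module Λ Q]

instance : AddCommGroup (Nakayama R Λ P) :=
  inferInstanceAs (AddCommGroup ((P →ₗ[Λ] Λ) →ₗ[R] dualizing R))

variable {Λ P} in
/-- The right action of `a : Λ` on `P^* = Hom_Λ(P, Λ)`, namely `(g · a)(x) = g(x) a`. -/
def rightMul (a : Λ) : (P →ₗ[Λ] Λ) →ₗ[R] (P →ₗ[Λ] Λ) where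
  toFun g :=
    { toFun := fun x => g x * a
      map_add' := fun x y => by rw [map_add, add_mul]
      map_smul' := fun c x => by simp [mul_assoc] }
  map_add' g h := LinearMap.ext fun x => add_mul (g x) (h x) a
  map_smul' r g := LinearMap.ext fun x => smul_mul_assoc r (g x) a

variable {R Λ P} in
/-- An element of `ν(P)`, viewed as an `R`-linear map `Hom_Λ(P, Λ) → k`. -/
def Nakayama.hom (φ : Nakayama R Λ P) : (P →ₗ[Λ] Λ) →ₗ[R] dualizing R := φ

variable {R Λ P} in
theorem Nakayama.hom_ext {φ ψ : Nakayama R Λ P} (h : ∀ g, φ.hom g = ψ.hom g) : φ = ψ :=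
  LinearMap.ext h

/-- The left `Λ`-action on `ν(P)`: `(a • φ)(g) = φ(g · a)`. -/
instance : SMul Λ (Nakayama R Λ P) where
  smul a φ := φ.hom ∘ₗ rightMul R a

variable {R Λ P} in
theorem Nakayama.smul_hom (a : Λ) (φ : Nakayama R Λ P) (g : P →ₗ[Λ] Λ) :
    (a • φ).hom g = φ.hom (rightMul R a g) := rfl

instance : Module Λ (Nakayama R Λ P) where
  one_smul φ := Nakayama.hom_ext fun g => congrArg φ.hom (LinearMap.ext fun x => mul_one (g x))
  mul_smul a b φ := Nakayama.hom_ext fun g => congrArg φ.hom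
    (LinearMap.ext fun x => (mul_assoc (g x) a b).symm)
  smul_zero _ := rfl
  smul_add _ _ _ := rfl
  add_smul a b φ := Nakayama.hom_ext fun g => (congrArg φ.hom
    (show rightMul R (a + b) g = rightMul R a g + rightMul R b g from
      LinearMap.ext fun x => mul_add (g x) a b)).trans (map_add φ.hom _ _)
  zero_smul φ := Nakayama.hom_ext fun g => (congrArg φ.hom
    (show rightMul R (0 : Λ) g = 0 from
      LinearMap.ext fun x => mul_zero (g x))).trans (map_zero φ.hom)

variable {Λ P Q} in
/-- The dual `f^* : Q^* → P^*` of `f : P → Q`, namely `g ↦ g ∘ f`. -/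
def starMap (f : P →ₗ[Λ] Q) : (Q →ₗ[Λ] Λ) →ₗ[R] (P →ₗ[Λ] Λ) where
  toFun g := g ∘ₗ f
  map_add' _ _ := rfl
  map_smul' _ _ := rfl

variable {Λ P Q} in
/-- `ν(f) : ν(P) → ν(Q)`, namely `φ ↦ φ ∘ f^*`. -/
def nakayamaMap (f : P →ₗ[Λ] Q) : Nakayama R Λ P →ₗ[Λ] Nakayama R Λ Q where
  toFun φ := φ.hom ∘ₗ starMap R f
  map_add' _ _ := rfl
  map_smul' a φ := Nakayama.hom_ext fun g => congrArg φ.hom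
    (show rightMul R a (starMap R f g) = starMap R f (rightMul R a g) from rfl)

end Structure

variable [IsArtinianRing Λ] (M N : Type u) [AddCommGroup M] [Module Λ M] [Module.Finite Λ M]
  [AddCommGroup N] [Module Λ N]

/-- The Auslander-Reiten translation `τ(M) = ker (ν(π⁻¹) : ν(P⁻¹(M)) → ν(P⁰(M)))`. -/
def tau : Submodule Λ (Nakayama R Λ (resTerm Λ M 1)) :=
  LinearMap.ker (nakayamaMap R (resD Λ M 0))

/-- The `n`-Auslander-Reiten translation `τ_n(M) = τ(Ω^{n-1} M)`, for `n ≥ 1`. -/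
def tauN (n : ℕ) : Submodule Λ (Nakayama R Λ (resTerm Λ (syzygy Λ M (n - 1)) 1)) :=
  tau R Λ (syzygy Λ M (n - 1))

/-- `N` belongs to the `τ_n`-perpendicular category of `M`, for `n ≥ 1`: `Hom_Λ(N, τ_n M) = 0` and
`Ext^i_Λ(M, N) = 0` for `1 ≤ i ≤ n - 1`. -/
def InTauPerp (n : ℕ) : Prop :=
  (∀ f : N →ₗ[Λ] tauN R Λ M n, f = 0) ∧
    ∀ i : ℕ, 1 ≤ i → i ≤ n - 1 →
      Subsingleton (Abelian.Ext (ModuleCat.of Λ M) (ModuleCat.of Λ N) i)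

end Translation

/-! ### `τ_n`-rigid, `τ_n`-tilting and `τ_{n,m}`-tilting modules over an Artin algebra -/

section Tilting

variable (R : Type w) [CommRing R] [IsArtinianRing R]
  (Λ : Type u) [Ring Λ] [Algebra R Λ] [Module.Finite R Λ]
  (M : Type u) [AddCommGroup M] [Module Λ M] [Module.Finite Λ M]

/-- `M` is `τ_n`-rigid in `mod Λ`, for `n ≥ 1`: `M` lies in its own `τ_n`-perpendicular category. -/
def IsTauRigid (n : ℕ) : Prop :=
  haveI : IsArtinianRing Λ := IsArtinianRing.of_finite R Λ
  InTauPerp R Λ M M n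

/-- `M` is `τ_n`-tilting in `mod Λ`, for `n ≥ 1`: the truncation `P^•_{≥ -n}(M)` of the minimal
projective resolution of `M` is silting in `K^b(proj Λ)`. -/
def IsTauTilting (n : ℕ) : Prop :=
  haveI : IsArtinianRing Λ := IsArtinianRing.of_finite R Λ
  IsSilting ((HomotopyCategory.quotient (ModuleCat.{u} Λ) (ComplexShape.up ℤ)).obj
    (truncRes Λ M n))

/-- The quotient algebra `Γ_M = Λ / ann(M)`. -/
abbrev QuotAnn (Λ : Type u) [Ring Λ] (M : Type u) [AddCommGroup M] [Module Λ M] : Type u :=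
  Λ ⧸ Module.annihilator Λ M

/-- The module structure of `M` over `Γ_M`, with `[a] • x = a • x`. -/
@[reducible] def moduleQuotAnn (Λ : Type u) [Ring Λ] (M : Type u) [AddCommGroup M] [Module Λ M] :
    Module (QuotAnn Λ M) M :=
  Module.quotientAnnihilator

attribute [local instance] moduleQuotAnn

theorem mk_smul (Λ : Type u) [Ring Λ] (M : Type u) [AddCommGroup M] [Module Λ M] (a : Λ) (x : M) :
    (Ideal.Quotient.mk (Module.annihilator Λ M) a : QuotAnn Λ M) • x = a • x := rfl

theorem finite_quotAnn (Λ : Type u) [Ring Λ] (M : Type u) [AddCommGroup M] [Module Λ M]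
    [Module.Finite Λ M] : Module.Finite (QuotAnn Λ M) M := by
  obtain ⟨s, hs⟩ := (inferInstance : Module.Finite Λ M).fg_top
  refine ⟨s, ?_⟩
  rw [eq_top_iff]
  intro x _
  have hx : x ∈ Submodule.span Λ (s : Set M) := hs ▸ Submodule.mem_top
  induction hx using Submodule.span_induction with
  | mem x h => exact Submodule.subset_span h
  | zero => exact Submodule.zero_mem _
  | add x y _ _ hx hy => exact Submodule.add_mem _ (hx trivial) (hy trivial)
  | smul a x _ hx => exact mk_smul Λ M a x ▸ Submodule.smul_mem _ _ (hx trivial)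

theorem finite_algebra_quotAnn (R : Type w) [CommRing R] (Λ : Type u) [Ring Λ] [Algebra R Λ]
    [Module.Finite R Λ] (M : Type u) [AddCommGroup M] [Module Λ M] :
    Module.Finite R (QuotAnn Λ M) :=
  Module.Finite.of_surjective (Ideal.Quotient.mkₐ R (Module.annihilator Λ M)).toLinearMap
    (Ideal.Quotient.mkₐ_surjective R _)

/-- `M` is `τ_{n,m}`-tilting in `mod Λ`, for `n, m ≥ 1`: it is `τ_n`-tilting in `mod Λ` and
`τ_m`-rigid in `mod Γ_M`, where `Γ_M = Λ / ann(M)`. -/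
def IsTauNMTilting (n m : ℕ) : Prop :=
  haveI := finite_algebra_quotAnn R Λ M
  haveI := finite_quotAnn Λ M
  IsTauTilting R Λ M n ∧ IsTauRigid R (QuotAnn Λ M) M m

end Tilting

end TauTilting

end

namespace TauTilting

/-! Let `P₁ → P₀ → M → 0` and `Q₁ → Q₀ → M → 0` be the minimal projective presentations over `Λ` and
over `Γ = Λ / ann M`, with differentials `d` and `e`. Rigidity is handled through a factorization
property: every map from the degree `-1` term to `M` factors through the differential.

Silting gives this over `Λ`. Since `Hom(X, X[1]) = 0` for `X = (P₁ → P₀)`, a lift `P₁ → P₀` of a map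
`P₁ → M` has the form `a ≫ d + d ≫ b`, and the first summand dies in `M`
(`exists_factor_of_isPresilting`). The property passes to `Γ` because `Q₀` is `P₀ / (ann M) P₀`,
`P₁` maps onto `Q₁`, and every map `P₀ → M` kills `(ann M) P₀` (`exists_factor_quotient`). Finally,
as `Hom(M, νQ) ≅ D Hom(Q, M)` suggests, the property over `Γ` forces a map `M → νQ₁` with image in
`τM = ker ν(e)` to vanish; a dual basis computation shows it directly
(`eq_zero_of_nakayamaMap_comp_eq_zero`). -/

/-! ### Null-homotopic maps from a two-term complex to its shift. -/

-- The neighbouring terms in degrees `-2` and `1` vanish, so `f` alone is a cocycle of degree one,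
-- that is, a chain map `K ⟶ K⟦1⟧`. A null-homotopy of it has `a` and `b` as its components, up to
-- sign.
open CochainComplex.HomComplex in
theorem exists_homotopy_components {C : Type*} [Category* C] [Preadditive C]
    (K : CochainComplex C ℤ) (h1 : Limits.IsZero (K.X 1)) (h2 : Limits.IsZero (K.X (-2)))
    (hK : ∀ g : (HomotopyCategory.quotient C (ComplexShape.up ℤ)).obj K ⟶
      (shiftFunctor (HomotopyCategory C (ComplexShape.up ℤ)) (1 : ℤ)).obj
        ((HomotopyCategory.quotient C (ComplexShape.up ℤ)).obj K), g = 0)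
    (f : K.X (-1) ⟶ K.X 0) :
    ∃ (a : K.X (-1) ⟶ K.X (-1)) (b : K.X 0 ⟶ K.X 0), f = a ≫ K.d (-1) 0 + K.d (-1) 0 ≫ b := by
  let z : Cocycle K K 1 := Cocycle.mk (Cochain.single f 1) 2 rfl (by
    rw [Cochain.δ_single f 1 2 rfl (-2) 1 (by lia) (by lia), h1.eq_zero_of_tgt (f ≫ K.d 0 1),
      h2.eq_zero_of_src (K.d (-2) (-1) ≫ f)]
    simp)
  let φ : K ⟶ K⟦(1 : ℤ)⟧ := Cocycle.homOf (z.rightShift 1 0 (by lia))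
  have hφ : (HomotopyCategory.quotient C (ComplexShape.up ℤ)).map φ = 0 := by
    rw [← cancel_mono (((HomotopyCategory.quotient C (ComplexShape.up ℤ)).commShiftIso
      (1 : ℤ)).hom.app K)]
    rw [Limits.zero_comp]
    exact hK _
  let ho : Homotopy φ 0 := HomotopyCategory.homotopyOfEq _ _ (by simpa using hφ)
  have hδ := δ_ofHomotopy ho
  have hw := Cochain.δ_rightUnshift (Cochain.ofHomotopy ho) 0 (by lia) 1 0 (by lia)
  rw [hδ] at hw
  have hz : (Cochain.ofHom φ - Cochain.ofHom (0 : K ⟶ K⟦(1 : ℤ)⟧)).rightUnshift 1 (by lia)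
      = Cochain.single f 1 := by
    rw [Cochain.ofHom_zero, sub_zero, Cocycle.cochain_ofHom_homOf_eq_coe]
    exact Cochain.rightUnshift_rightShift _ _ _ _
  rw [hz] at hw
  have := Cochain.congr_v hw (-1) 0 (by lia)
  rw [δ_v 0 1 (by lia) _ (-1) 0 (by lia) (-1) 0 (by lia) (by lia), Cochain.units_smul_v,
    Cochain.single_v, Int.negOnePow_one] at this
  simp only [Units.neg_smul, one_smul] at this
  -- Undoing the shift costs a sign: the unshifted homotopy `h` satisfies `h ≫ d - d ≫ h = -f`,
  -- hence the minus sign on the first witness only.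
  refine ⟨-(((Cochain.ofHomotopy ho).rightUnshift 0 (by lia)).v (-1) (-1) (by lia)),
    (((Cochain.ofHomotopy ho).rightUnshift 0 (by lia)).v 0 0 (by lia)), ?_⟩
  rw [← neg_neg f, ← this, Preadditive.neg_comp]
  abel

/-! ### Semilinear maps along a change of rings. -/

section Semilinear

variable {Λ Γ : Type*} [Ring Λ] [Ring Γ] {σ : Λ →+* Γ}

/-- A semilinear map which hits everything modulo a superfluous kernel is surjective. -/
theorem surjective_of_superfluous [RingHomSurjective σ] {P Q X : Type*} [AddCommGroup P]
    [Module Λ P] [AddCommGroup Q] [Module Γ Q] [AddCommGroup X] [Module Γ X] (f : P →ₛₗ[σ] Q)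
    (p : Q →ₗ[Γ] X) (hp : ∀ N : Submodule Γ Q, N ⊔ LinearMap.ker p = ⊤ → N = ⊤)
    (h : ∀ y, ∃ x, p (f x) = p y) : Function.Surjective f := by
  refine LinearMap.range_eq_top.mp (hp _ (eq_top_iff.mpr fun y _ => ?_))
  obtain ⟨x, hx⟩ := h y
  refine Submodule.mem_sup.mpr ⟨f x, ⟨x, rfl⟩, y - f x, ?_, by abel⟩
  rw [LinearMap.mem_ker, map_sub, hx, sub_self]

/-- The lifting property of projective modules for semilinear maps. -/
theorem exists_semilinear_lift {P Q X : Type*} [AddCommGroup P] [Module Λ P]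
    [Module.Projective Λ P] [AddCommGroup Q] [Module Γ Q] [AddCommGroup X] [Module Γ X]
    (g : P →ₛₗ[σ] X) (p : Q →ₗ[Γ] X) (h : ∀ x, g x ∈ LinearMap.range p) :
    ∃ f : P →ₛₗ[σ] Q, ∀ x, p (f x) = g x := by
  -- Restricting scalars along `σ` turns semilinear maps into `Λ`-linear ones, so the ordinary
  -- lifting property applies.
  let _ : Module Λ Q := Module.compHom Q σ
  let _ : Module Λ (LinearMap.range p) := Module.compHom _ σ
  let p' : Q →ₗ[Λ] LinearMap.range p :=
    { p.rangeRestrict.toAddMonoidHom with map_smul' := fun a x => p.rangeRestrict.map_smul (σ a) x }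
  let g' : P →ₗ[Λ] LinearMap.range p :=
    { toFun := fun x => ⟨g x, h x⟩
      map_add' := fun x y => Subtype.ext (map_add g x y)
      map_smul' := fun a x => Subtype.ext (map_smulₛₗ g a x) }
  obtain ⟨f, hf⟩ := Module.projective_lifting_property p' g' p.surjective_rangeRestrict
  exact ⟨{ f.toAddMonoidHom with map_smul' := fun a x => f.map_smul a x },
    fun x => congrArg Subtype.val (LinearMap.congr_fun hf x)⟩

end Semilinear

/-! ### Descent of presentations to a quotient ring. -/

/-- A semilinear map along `Λ → Λ / I` descends to `P / I P`. -/
theorem exists_lift_quotient_smul_top {Λ : Type*} [Ring Λ] {I : Ideal Λ} [I.IsTwoSided]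
    {P N : Type*} [AddCommGroup P] [Module Λ P] [AddCommGroup N] [Module (Λ ⧸ I) N]
    (h : P →ₛₗ[Ideal.Quotient.mk I] N) :
    ∃ h' : (P ⧸ I • (⊤ : Submodule Λ P)) →ₗ[Λ ⧸ I] N,
      ∀ x, h' (Submodule.Quotient.mk x) = h x := by
  have hle : I • (⊤ : Submodule Λ P) ≤ LinearMap.ker h := by
    refine Submodule.smul_le.mpr fun a ha x _ => ?_
    rw [LinearMap.mem_ker, map_smulₛₗ, Ideal.Quotient.eq_zero_iff_mem.mpr ha, zero_smul]
  refine ⟨{ (Submodule.liftQ _ h hle).toAddMonoidHom with map_smul' := fun a x => ?_ },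
    fun x => rfl⟩
  obtain ⟨a, rfl⟩ := Ideal.Quotient.mk_surjective a
  obtain ⟨x, rfl⟩ := Submodule.Quotient.mk_surjective _ x
  exact map_smulₛₗ h a x

/-- Let `P₁ → P₀ → M → 0` and `Q₁ → Q₀ → M → 0` be projective presentations of a module `M` killed
by `I`, over `Λ` and over `Λ / I`, which are minimal except possibly at `P₁`. If every map
`P₁ → M` factors through `P₀`, then every map `Q₁ → M` factors through `Q₀`. -/
theorem exists_factor_quotient {Λ : Type u} [Ring Λ] (I : Ideal Λ) [I.IsTwoSided]
    {M P₁ P₀ Q₁ Q₀ : Type*} [AddCommGroup M] [Module Λ M] [Module (Λ ⧸ I) M]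
    (hM : ∀ (a : Λ) (x : M), Ideal.Quotient.mk I a • x = a • x)
    [AddCommGroup P₁] [Module Λ P₁] [Module.Projective Λ P₁]
    [AddCommGroup P₀] [Module Λ P₀] [Module.Projective Λ P₀]
    [AddCommGroup Q₁] [Module (Λ ⧸ I) Q₁]
    [AddCommGroup Q₀] [Module (Λ ⧸ I) Q₀] [Module.Projective (Λ ⧸ I) Q₀]
    (d : P₁ →ₗ[Λ] P₀) (p : P₀ →ₗ[Λ] M) (e : Q₁ →ₗ[Λ ⧸ I] Q₀) (q : Q₀ →ₗ[Λ ⧸ I] M)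
    (hd : LinearMap.range d = LinearMap.ker p) (hps : Function.Surjective p)
    (hp : ∀ N : Submodule Λ P₀, N ⊔ LinearMap.ker p = ⊤ → N = ⊤)
    (he : LinearMap.range e = LinearMap.ker q) (hqs : Function.Surjective q)
    (hq : ∀ N : Submodule (Λ ⧸ I) Q₀, N ⊔ LinearMap.ker q = ⊤ → N = ⊤)
    (he' : ∀ N : Submodule (Λ ⧸ I) Q₁, N ⊔ LinearMap.ker e = ⊤ → N = ⊤)
    (hf : ∀ g : P₁ →ₗ[Λ] M, ∃ k : P₀ →ₗ[Λ] M, g = k ∘ₗ d)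
    (g : Q₁ →ₗ[Λ ⧸ I] M) : ∃ k : Q₀ →ₗ[Λ ⧸ I] M, g = k ∘ₗ e := by
  -- compare the two presentations
  let p' : P₀ →ₛₗ[Ideal.Quotient.mk I] M :=
    { p.toAddMonoidHom with map_smul' := fun a x => (p.map_smul a x).trans (hM a _).symm }
  obtain ⟨α, hα⟩ := exists_semilinear_lift p' q fun x => hqs _
  replace hα : ∀ x, q (α x) = p x := hα
  have hαs : Function.Surjective α := surjective_of_superfluous α q hq fun y => by
    obtain ⟨x, hx⟩ := hps (q y)
    exact ⟨x, by rw [hα, hx]⟩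
  have hdp : ∀ x, p (d x) = 0 := fun x => LinearMap.mem_ker.mp (hd ▸ ⟨x, rfl⟩)
  obtain ⟨β, hβ⟩ := exists_semilinear_lift (α.comp d) e fun x => by
    rw [he, LinearMap.mem_ker, LinearMap.comp_apply, hα, hdp]
  have hβs : Function.Surjective β := surjective_of_superfluous β e he' fun y => by
    obtain ⟨x, hx⟩ := hαs (e y)
    have hx' : x ∈ LinearMap.range d := by
      rw [hd, LinearMap.mem_ker, ← hα, hx]
      exact LinearMap.mem_ker.mp (he ▸ ⟨y, rfl⟩)
    obtain ⟨w, rfl⟩ := hx'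
    exact ⟨w, by rw [hβ, LinearMap.comp_apply, hx]⟩
  -- descend to `P₀ / I P₀`, which is isomorphic to `Q₀`
  obtain ⟨α', hα'⟩ := exists_lift_quotient_smul_top α
  obtain ⟨p₁, hp₁⟩ := exists_lift_quotient_smul_top p'
  replace hp₁ : ∀ x, p₁ (Submodule.Quotient.mk x) = p x := hp₁
  have hqα' : ∀ y, q (α' y) = p₁ y := fun y => by
    obtain ⟨x, rfl⟩ := Submodule.Quotient.mk_surjective _ y
    rw [hα', hp₁, hα]
  obtain ⟨s, hs⟩ := Module.projective_lifting_property α' LinearMap.id fun y => by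
    obtain ⟨x, rfl⟩ := hαs y
    exact ⟨_, hα' x⟩
  replace hs : ∀ y, α' (s y) = y := fun y => LinearMap.congr_fun hs y
  -- Surjectivity of the section `s` makes `α'` bijective. The preimage of `range s` in `P₀`
  -- together with `ker p` spans `P₀`, because `s (α x)` and `x` have the same image in `M`;
  -- superfluity of `ker p` concludes.
  have hss : Function.Surjective s := by
    let N : Submodule Λ P₀ :=
      { carrier := {x | Submodule.Quotient.mk x ∈ LinearMap.range s}
        add_mem' := fun hx hy => (LinearMap.range s).add_mem hx hy
        zero_mem' := zero_mem (LinearMap.range s)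
        smul_mem' := fun a x hx => (LinearMap.range s).smul_mem (Ideal.Quotient.mk I a) hx }
    have hN : N = ⊤ := hp N <| eq_top_iff.mpr fun x _ => by
      obtain ⟨y, hy⟩ := Submodule.Quotient.mk_surjective _ (s (α x))
      refine Submodule.mem_sup.mpr ⟨y, ⟨α x, hy.symm⟩, x - y, ?_, by abel⟩
      rw [LinearMap.mem_ker, map_sub, ← hp₁ y, hy, ← hqα', hs, hα, sub_self]
    intro y
    obtain ⟨x, rfl⟩ := Submodule.Quotient.mk_surjective _ y
    exact (hN ▸ Submodule.mem_top : x ∈ N)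
  have hsα' : ∀ y, s (α' y) = y := fun y => by
    obtain ⟨z, rfl⟩ := hss y
    rw [hs]
  let gβ : P₁ →ₗ[Λ] M :=
    { toFun := fun x => g (β x)
      map_add' := fun x y => by rw [map_add, map_add]
      map_smul' := fun a x => by rw [map_smulₛₗ, map_smul, hM]; rfl }
  obtain ⟨h, hh⟩ := hf gβ
  let h₀ : P₀ →ₛₗ[Ideal.Quotient.mk I] M :=
    { h.toAddMonoidHom with map_smul' := fun a x => (h.map_smul a x).trans (hM a _).symm }
  -- `h` descends to `P₀ / I P₀` because its target is killed by `I`; precomposing with `s`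
  -- transports it to `Q₀`.
  obtain ⟨h₁, hh₁⟩ := exists_lift_quotient_smul_top h₀
  refine ⟨h₁ ∘ₗ s, LinearMap.ext fun y => ?_⟩
  -- Since `β` is onto, the identity on `Q₁` may be tested after pulling back to `P₁`.
  obtain ⟨x, rfl⟩ := hβs y
  rw [LinearMap.comp_apply, LinearMap.comp_apply, hβ, LinearMap.comp_apply, ← hα', hsα', hh₁]
  exact LinearMap.congr_fun hh x

/-! ### Dual bases and the Nakayama functor. -/

/-- A finitely generated projective module has a finite dual basis. -/
theorem exists_dualBasis (Λ : Type*) [Ring Λ] (P : Type*) [AddCommGroup P] [Module Λ P]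
    [Module.Finite Λ P] [Module.Projective Λ P] :
    ∃ (n : ℕ) (p : Fin n → P) (p' : Fin n → P →ₗ[Λ] Λ), ∀ x, ∑ i, p' i x • p i = x := by
  obtain ⟨n, f, hf⟩ := Module.Finite.exists_fin' Λ P
  obtain ⟨s, hs⟩ := Module.projective_lifting_property f LinearMap.id hf
  refine ⟨n, fun i => f (Pi.single i 1), fun i => LinearMap.proj i ∘ₗ s, fun x => ?_⟩
  conv_rhs => rw [← LinearMap.id_apply (R := Λ) x, ← hs, LinearMap.comp_apply,
    ← Finset.univ_sum_single (s x), map_sum]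
  refine Finset.sum_congr rfl fun i _ => ?_
  rw [← map_smul, ← Pi.single_smul]
  simp

/-- If every map `Q₁ → M` factors through `e : Q₁ → Q₀`, then every map `M → ν(Q₁)` with image
in the kernel of `ν(e)` is zero. -/
theorem eq_zero_of_nakayamaMap_comp_eq_zero (R : Type w) [CommRing R] {Γ : Type u} [Ring Γ]
    [Algebra R Γ] {Q₁ Q₀ M : Type u} [AddCommGroup Q₁] [Module Γ Q₁] [AddCommGroup Q₀]
    [Module Γ Q₀] [AddCommGroup M] [Module Γ M] [Module.Finite Γ Q₁] [Module.Projective Γ Q₁]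
    [Module.Finite Γ Q₀] [Module.Projective Γ Q₀] (e : Q₁ →ₗ[Γ] Q₀)
    (he : ∀ g : Q₁ →ₗ[Γ] M, ∃ k : Q₀ →ₗ[Γ] M, g = k ∘ₗ e)
    (f : M →ₗ[Γ] Nakayama R Γ Q₁) (hf : nakayamaMap R e ∘ₗ f = 0) : f = 0 := by
  obtain ⟨n, q, q', hq⟩ := exists_dualBasis Γ Q₁
  obtain ⟨l, p, p', hp⟩ := exists_dualBasis Γ Q₀
  refine LinearMap.ext fun m => Nakayama.hom_ext fun v => ?_
  -- The factorization is applied to the rank-one map `x ↦ v x • m`.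
  obtain ⟨k, hk⟩ := he (LinearMap.toSpanSingleton Γ M m ∘ₗ v)
  have hadd : ∀ {N : Type u} [AddCommGroup N] [Module Γ N] {ι : Type} (s : Finset ι)
      (φ : ι → Nakayama R Γ N) (g : N →ₗ[Γ] Γ), (∑ i ∈ s, φ i).hom g = ∑ i ∈ s, (φ i).hom g := by
    intro N _ _ ι s φ g
    exact LinearMap.sum_apply s φ g
  -- Expand `v` in the dual basis of `Q₁` and move the coefficients `v (q i)` onto `m` by linearity
  -- of `f`.
  have h1 : (f m).hom v = ∑ i, (f (k (e (q i)))).hom (q' i) := by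
    have h2 : v = ∑ i, rightMul R (v (q i)) (q' i) := by
      ext x
      conv_lhs => rw [← hq x, map_sum]
      rw [LinearMap.sum_apply]
      exact Finset.sum_congr rfl fun i _ => map_smul v _ _
    conv_lhs => rw [h2, map_sum]
    refine Finset.sum_congr rfl fun i _ => ?_
    have h3 : k (e (q i)) = v (q i) • m := (LinearMap.congr_fun hk (q i)).symm
    rw [h3, map_smul, Nakayama.smul_hom]
  -- Expanding `e (q i)` in the dual basis of `Q₀` and summing over `i` reassembles `p' j ∘ e`, so
  -- each term becomes a value of `ν(e) ∘ f`.
  have h4 : ∀ i, (f (k (e (q i)))).hom (q' i) =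
      ∑ j, (f (k (p j))).hom (rightMul R (p' j (e (q i))) (q' i)) := by
    intro i
    conv_lhs => rw [← hp (e (q i)), map_sum, map_sum, hadd]
    exact Finset.sum_congr rfl fun j _ => by rw [map_smul, map_smul, Nakayama.smul_hom]
  rw [h1, Finset.sum_congr rfl fun i _ => h4 i, Finset.sum_comm]
  change _ = (0 : Nakayama R Γ Q₁).hom v
  refine Finset.sum_eq_zero fun j _ => ?_
  rw [← map_sum]
  have h5 : ∑ i, rightMul R (p' j (e (q i))) (q' i) = starMap R e (p' j) := by
    ext x
    change _ = p' j (e x)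
    conv_rhs => rw [← hq x, map_sum, map_sum]
    rw [LinearMap.sum_apply]
    exact Finset.sum_congr rfl fun i _ => by rw [map_smul, map_smul]; rfl
  rw [h5]
  exact LinearMap.congr_fun (LinearMap.congr_fun hf (k (p j))) (p' j)

/-! ### The truncated minimal resolution and its factorization property. -/

section Truncation

variable (Λ : Type u) [Ring Λ] [IsArtinianRing Λ] (M : Type u) [AddCommGroup M] [Module Λ M]
  [Module.Finite Λ M]

theorem resCover_spec (i : ℕ) : IsProjectiveCover (resCover Λ M i) :=
  projCoverMap_spec Λ (syzygy Λ M i)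

instance (i : ℕ) : Module.Finite Λ (resTerm Λ M i) := (resCover_spec Λ M i).finite

instance (i : ℕ) : Module.Projective Λ (resTerm Λ M i) := (resCover_spec Λ M i).projective

/-- The term in degree `-i` of the truncated minimal projective resolution, for `i ≤ n`. -/
noncomputable def truncResXIso (n i : ℕ) (hi : i ≤ n) (j : ℤ) (hj : j = -(i : ℤ)) :
    (truncRes Λ M n).X j ≅ ModuleCat.of Λ (resTerm Λ M i) :=
  -- The embedding sends `k` to `-n + k`, so degree `-i` has index `n - i`; `i ≤ n` keeps the
  -- natural subtraction exact.
  have h : (ComplexShape.embeddingUpIntGE (-(n : ℤ))).f (n - i) = j := by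
    simp [hj, hi]
    lia
  HomologicalComplex.extendXIso _ _ h ≪≫ HomologicalComplex.restrictionXIso _ _ h ≪≫
    (minRes Λ M).extendXIso ComplexShape.embeddingDownNat (i := i) (by simp [hj])

theorem truncRes_d (n i : ℕ) (hi : i + 1 ≤ n) (j j' : ℤ) (hj : j = -((i + 1 : ℕ) : ℤ))
    (hj' : j' = -(i : ℤ)) :
    (truncRes Λ M n).d j j' = (truncResXIso Λ M n (i + 1) hi j hj).hom ≫
      ModuleCat.ofHom (resD Λ M i) ≫ (truncResXIso Λ M n i (by lia) j' hj').inv := by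
  have h : (ComplexShape.embeddingUpIntGE (-(n : ℤ))).f (n - (i + 1)) = j := by
    simp [hj, hi]
    lia
  have h' : (ComplexShape.embeddingUpIntGE (-(n : ℤ))).f (n - i) = j' := by
    simp [hj', show i ≤ n by lia]
    lia
  have hd : (minRes Λ M).d (i + 1) i = ModuleCat.ofHom (resD Λ M i) :=
    ChainComplex.of_d (resTerm Λ M) (fun i => ModuleCat.ofHom (resD Λ M i)) i
  refine (HomologicalComplex.extend_d_eq _ _ h h').trans ?_
  rw [HomologicalComplex.restriction_d_eq _ _ h h',
    show (resComplex Λ M).d j j' = _ from HomologicalComplex.extend_d_eq _ _ (i := i + 1) (j := i) (by simp [hj]) (by simp [hj']), hd]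
  simp only [truncResXIso, Category.assoc]
  rfl

theorem isZero_truncRes_X (n : ℕ) (j : ℤ) (hj : j < -n ∨ 0 < j) :
    Limits.IsZero ((truncRes Λ M n).X j) := by
  rcases hj with hj | hj
  · refine HomologicalComplex.isZero_stupidTrunc_X _ _ _ fun i hi => ?_
    simp at hi
    lia
  · have h : (ComplexShape.embeddingUpIntGE (-(n : ℤ))).f (j + n).toNat = j := by
      simp
      lia
    refine Limits.IsZero.of_iso ?_ (HomologicalComplex.stupidTruncXIso _ _ h)
    refine HomologicalComplex.isZero_extend_X _ _ _ fun i hi => ?_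
    simp at hi
    lia

theorem range_resD (i : ℕ) : LinearMap.range (resD Λ M i) = LinearMap.ker (resCover Λ M i) := by
  rw [resD, LinearMap.range_comp,
    LinearMap.range_eq_top.mpr (resCover_spec Λ M (i + 1)).surjective,
    Submodule.map_top]
  exact Submodule.range_subtype _

/-- The differential is a projective cover followed by an inclusion. This makes its kernel
superfluous, which is minimality in the next degree. -/
theorem ker_resD (i : ℕ) : LinearMap.ker (resD Λ M i) = LinearMap.ker (resCover Λ M (i + 1)) :=
  LinearMap.ker_comp_of_ker_eq_bot _ (Submodule.ker_subtype _)

theorem resCover_resD (i : ℕ) (x : resTerm Λ M (i + 1)) : resCover Λ M i (resD Λ M i x) = 0 :=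
  LinearMap.mem_ker.mp (range_resD Λ M i ▸ ⟨x, rfl⟩)

/-- If the truncation `P⁻¹(M) → P⁰(M)` is presilting, then every map `P⁻¹(M) → M` factors through
the differential. -/
theorem exists_factor_of_isPresilting
    (h : IsPresilting ((HomotopyCategory.quotient (ModuleCat.{u} Λ) (ComplexShape.up ℤ)).obj
      (truncRes Λ M 1))) (g : resTerm Λ M 1 →ₗ[Λ] M) :
    ∃ k : resTerm Λ M 0 →ₗ[Λ] M, g = k ∘ₗ resD Λ M 0 := by
  let p : resTerm Λ M 0 →ₗ[Λ] M := resCover Λ M 0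
  obtain ⟨f, hf⟩ := Module.projective_lifting_property p g
    (resCover_spec Λ M 0).surjective
  let i₁ := truncResXIso Λ M 1 1 le_rfl (-1) rfl
  let i₀ := truncResXIso Λ M 1 0 (by lia) 0 rfl
  obtain ⟨a, b, hab⟩ := exists_homotopy_components (truncRes Λ M 1)
    (isZero_truncRes_X Λ M 1 1 (by simp)) (isZero_truncRes_X Λ M 1 (-2) (by simp))
    (fun g => h.2 1 one_pos g) (i₁.hom ≫ ModuleCat.ofHom f ≫ i₀.inv)
  rw [truncRes_d Λ M 1 0 le_rfl (-1) 0 rfl rfl] at hab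
  have hab' : ModuleCat.ofHom f = (i₁.inv ≫ a ≫ i₁.hom) ≫ ModuleCat.ofHom (resD Λ M 0) +
      ModuleCat.ofHom (resD Λ M 0) ≫ (i₀.inv ≫ b ≫ i₀.hom) := by
    rw [← cancel_epi i₁.hom, ← cancel_mono i₀.inv, Category.assoc, hab]
    simp [i₁, i₀]
  refine ⟨p ∘ₗ (i₀.inv ≫ b ≫ i₀.hom).hom, LinearMap.ext fun x => ?_⟩
  rw [← hf, LinearMap.comp_apply]
  have hx : f x = resD Λ M 0 ((i₁.inv ≫ a ≫ i₁.hom).hom x) +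
      (i₀.inv ≫ b ≫ i₀.hom).hom (resD Λ M 0 x) := LinearMap.congr_fun (congrArg (·.hom) hab') x
  have hp : ∀ y, p (resD Λ M 0 y) = 0 := resCover_resD Λ M 0
  -- The summand ending in the differential vanishes under `p`; the other already factors through
  -- the differential.
  rw [hx, map_add, hp, zero_add]
  rfl

end Truncation

end TauTilting

/-! ### The proposition. -/

open TauTilting in
theorem mainTheorem12 {R : Type w} [CommRing R] [IsArtinianRing R]
    {Λ : Type u} [Ring Λ] [Algebra R Λ] [Module.Finite R Λ]
    (M : Type u) [AddCommGroup M] [Module Λ M] [Module.Finite Λ M]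
    (hM : TauTilting.IsTauTilting R Λ M 1) :
    TauTilting.IsTauNMTilting R Λ M 1 1 := by
  have := finite_algebra_quotAnn R Λ M
  let _ := moduleQuotAnn Λ M
  have := finite_quotAnn Λ M
  have : IsArtinianRing Λ := IsArtinianRing.of_finite R Λ
  have : IsArtinianRing (QuotAnn Λ M) := IsArtinianRing.of_finite R _
  -- For `m = 1` the `Ext` condition ranges over `1 ≤ i ≤ 0` and is vacuous, leaving `Hom(M, τM) =
  -- 0` over the quotient.
  refine ⟨hM, fun f => ?_, fun i h1 h2 => absurd h2 (by lia)⟩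
  have hP := resCover_spec Λ M 0
  have h₀ := resCover_spec (QuotAnn Λ M) M 0
  have h₁ := resCover_spec (QuotAnn Λ M) M 1
  -- `τ₁M` unfolds to `τ(Ω⁰M) = τM`, a submodule of `νQ₁`, so `f` may be tested after inclusion into
  -- `νQ₁`.
  have key : (Submodule.subtype _) ∘ₗ f = 0 :=
    eq_zero_of_nakayamaMap_comp_eq_zero (M := M) R (resD (QuotAnn Λ M) M 0)
      (exists_factor_quotient (Module.annihilator Λ M) (mk_smul Λ M) (resD Λ M 0) (resCover Λ M 0)
        (resD (QuotAnn Λ M) M 0) (resCover (QuotAnn Λ M) M 0) (range_resD Λ M 0) hP.surjective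
        hP.superfluous (range_resD _ M 0) h₀.surjective h₀.superfluous
        (by rw [ker_resD]; exact h₁.superfluous) (exists_factor_of_isPresilting Λ M hM.1))
      _ (LinearMap.ext fun m => LinearMap.mem_ker.mp (f m).2)
  exact LinearMap.ext fun m => Subtype.ext (LinearMap.congr_fun key m)
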